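/- Let $k$ be a field of characteristic $p>0$ and let $X$ be a variety over $k$ (an integral, separated scheme of finite type over $k$) such that $k$ is algebraically closed in the function field $K(X)$. Write $k^{1/p}$ for the field of $p$-th roots of the elements of $k$ (in a fixed algebraic closure of $k$), $Y_{\mathrm{red}}$ for the reduction of a scheme $Y$, and $Y^N$ for the normalisation of an integral scheme $Y$. For an intermediate field $k\subset l\subset k^{1/p}$ consider the condition $(\ast)$ $X\times_k l$ is an integral scheme, and the algebraic closure of $l$ in $K(X\times_k l)$ is equal to $k^{1/p}$ (that is, it is the image of an embedding of $k^{1/p}$ into $K(X\times_k l)$ over $l$; such an embedding is unique if it exists). Recall that, for field extensions $k\subset l\subset k'$ and a morphism of schemes $\varphi\colon X'\to X$, where $X'$ comes with a structure morphism to $\operatorname{Spec} k'$ compatible with $\varphi$, the pair $(k\subset l\subset k',\varphi)$ is an *elemental extension* of $(k,X)$ if $k\subset l$ is purely inseparable with $l^p\subset k$, $X\times_k l$ is integral, the induced morphism $X'\to X\times_k l$ is the normalisation of $X\times_k l$, $\varphi$ is its composite with the projection to $X$, and $k'$ is the algebraic closure of $l$ in $K(X')$. Then the following hold. 1. There exists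 an intermediate field $k\subset l\subset k^{1/p}$ satisfying $(\ast)$. Moreover, for every $l$ satisfying $(\ast)$, if $X':=((X\times_k k^{1/p})_{\mathrm{red}})^N$ and $\varphi\colon X'\to X$ is the induced morphism, then $(k\subset l\subset k^{1/p},\varphi\colon X'\to X)$ is an elemental extension of $(k,X)$ (with the induced structure morphism $X'\to\operatorname{Spec}k^{1/p}$). 2. For every intermediate field $k\subset l\subset k^{1/p}$ satisfying $(\ast)$, $X$ is geometrically reduced over $k$ if and only if $l=k^{1/p}$. -/

import Mathlib

open CategoryTheory CategoryTheory.Limits AlgebraicGeometry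

universe u

namespace Elemental

noncomputable section

/-! ### Base change along a field extension -/

/-- The morphism `Spec E ⟶ Spec F` of an extension of fields (more generally an algebra) `E / F`. -/
abbrev specMap (F E : Type u) [Field F] [Field E] [Algebra F E] :
    Spec (.of E) ⟶ Spec (.of F) :=
  Spec.map (CommRingCat.ofHom (algebraMap F E))

/-- The base change `X ×_k E` of a `k`-scheme `f : X ⟶ Spec k` to an extension field `E` of `k`. -/
abbrev baseChange {k : Type u} [Field k] {X : Scheme.{u}} (f : X ⟶ Spec (.of k))
    (E : Type u) [Field E] [Algebra k E] : Scheme.{u} :=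
  pullback f (specMap k E)

lemma irreducibleSpace_of_homeomorph {S T : Type*} [TopologicalSpace S] [TopologicalSpace T]
    [IrreducibleSpace S] (e : S ≃ₜ T) : IrreducibleSpace T := by
  rw [irreducibleSpace_def]
  simpa using (IrreducibleSpace.isIrreducible_univ S).image e e.continuous.continuousOn

lemma universallyInjective_specMap (k E : Type u) [Field k] [Field E] [Algebra k E]
    [IsPurelyInseparable k E] : UniversallyInjective (specMap k E) := by
  refine ((tfae_universallyInjective (specMap k E)).out 0 1 rfl rfl).mpr ?_
  intro K _ g₁ g₂ h
  obtain ⟨a, rfl⟩ := Spec.map_surjective g₁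
  obtain ⟨b, rfl⟩ := Spec.map_surjective g₂
  simp only [specMap, ← Spec.map_comp] at h
  have h' := congrArg CommRingCat.Hom.hom (Spec.map_injective h)
  simp only [CommRingCat.hom_comp, CommRingCat.hom_ofHom] at h'
  congr 1
  exact CommRingCat.hom_ext (IsPurelyInseparable.injective_comp_algebraMap k E _ h')

/-- A purely inseparable base change of an irreducible scheme is irreducible. -/
instance irreducibleSpace_baseChange {k : Type u} [Field k] {X : Scheme.{u}} [IrreducibleSpace X]
    (f : X ⟶ Spec (.of k)) (E : Type u) [Field E] [Algebra k E] [IsPurelyInseparable k E] :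
    IrreducibleSpace (baseChange f E) := by
  have h1 : UniversallyInjective (specMap k E) := universallyInjective_specMap k E
  have h2 : IsIntegralHom (specMap k E) := by
    rw [IsIntegralHom.SpecMap_iff]
    exact (inferInstance : Algebra.IsIntegral k E).isIntegral
  have h3 : Surjective (specMap k E) := by
    refine ⟨fun y => ⟨IsLocalRing.closedPoint E, Subsingleton.elim _ _⟩⟩
  have h4 : UniversallyInjective (pullback.fst f (specMap k E)) :=
    (UniversallyInjective.isStableUnderBaseChange).of_isPullback
      (IsPullback.of_hasPullback f (specMap k E)).flip h1
  have h5 : IsHomeomorph (pullback.fst f (specMap k E)) :=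
    isHomeomorph_iff_continuous_isClosedMap_bijective.mpr
      ⟨Scheme.Hom.continuous _, Scheme.Hom.isClosedMap _, Scheme.Hom.injective _,
        Scheme.Hom.surjective _⟩
  exact irreducibleSpace_of_homeomorph (h5.homeomorph _).symm

/-! ### Reduction and normalisation -/

/-- The reduced closed subscheme `Y_red` of `Y` with the same underlying space. -/
abbrev red (Y : Scheme.{u}) : Scheme.{u} := Y.nilradical.subscheme

/-- The closed immersion `Y_red ⟶ Y`. -/
abbrev redι (Y : Scheme.{u}) : red Y ⟶ Y := Y.nilradical.subschemeι

instance isReduced_red (Y : Scheme.{u}) : IsReduced (red Y) := by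
  have (U : Y.nilradical.subschemeCover.openCover.I₀) :
      IsReduced (Y.nilradical.subschemeCover.openCover.X U) := by
    have : _root_.IsReduced (Y.nilradical.subschemeCover.X U) := by
      let V : Y.affineOpens := U
      change _root_.IsReduced (Γ(Y, V.1) ⧸ Y.nilradical.ideal V)
      rw [← Ideal.isRadical_iff_quotient_reduced]
      exact Ideal.radical_isRadical _
    change IsReduced (Spec _)
    infer_instance
  exact IsReduced.of_openCover _ Y.nilradical.subschemeCover.openCover

instance isIntegral_red (Y : Scheme.{u}) [IrreducibleSpace Y] : IsIntegral (red Y) := by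
  have h : IsHomeomorph (redι Y) := by
    refine isHomeomorph_iff_isEmbedding_surjective.mpr ⟨(redι Y).isEmbedding, ?_⟩
    rw [← Set.range_eq_univ, Scheme.IdealSheafData.range_subschemeι, Scheme.support_nilradical]
    rfl
  have : IrreducibleSpace (red Y) := irreducibleSpace_of_homeomorph (h.homeomorph _).symm
  exact isIntegral_of_irreducibleSpace_of_isReduced _

/-- The canonical morphism `Spec K(Y) ⟶ Y` of an integral scheme `Y`. -/
abbrev fromSpecFunctionField (Y : Scheme.{u}) [IsIntegral Y] : Spec Y.functionField ⟶ Y :=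
  Y.fromSpecStalk (genericPoint Y)

instance quasiCompact_fromSpecFunctionField (Y : Scheme.{u}) [IsIntegral Y] :
    QuasiCompact (fromSpecFunctionField Y) := by
  have : Subsingleton (Spec Y.functionField) :=
    inferInstanceAs (Subsingleton (PrimeSpectrum Y.functionField))
  exact ⟨fun U _ _ => (Set.subsingleton_of_subsingleton).isCompact⟩

/-- The normalisation `Y^N` of an integral scheme `Y`: the relative normalisation of `Y` in the
spectrum of its function field. -/
abbrev normalisation (Y : Scheme.{u}) [IsIntegral Y] : Scheme.{u} :=
  (fromSpecFunctionField Y).normalization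

/-- The canonical morphism `Y^N ⟶ Y`. -/
abbrev fromNormalisation (Y : Scheme.{u}) [IsIntegral Y] : normalisation Y ⟶ Y :=
  (fromSpecFunctionField Y).fromNormalization

/-- The morphism `ν : Z ⟶ Y` is the normalisation of the integral scheme `Y`
(up to a unique isomorphism over `Y`). -/
def IsNormalisation {Z Y : Scheme.{u}} [IsIntegral Y] (ν : Z ⟶ Y) : Prop :=
  ∃ e : Z ≅ normalisation Y, e.hom ≫ fromNormalisation Y = ν

/-- The reduced normalisation `Y_red^N` of an irreducible scheme `Y`. -/
abbrev reducedNormalisation (Y : Scheme.{u}) [IrreducibleSpace Y] : Scheme.{u} :=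
  normalisation (red Y)

/-- The canonical morphism `Y_red^N ⟶ Y`. -/
abbrev fromReducedNormalisation (Y : Scheme.{u}) [IrreducibleSpace Y] :
    reducedNormalisation Y ⟶ Y :=
  fromNormalisation (red Y) ≫ redι Y

/-! ### Algebraic closure in the function field -/

/-- The field embedding `F ⟶ K(X)` induced by `f : X ⟶ Spec F`. -/
def toFunctionField {F : Type u} [Field F] {X : Scheme.{u}} [IsIntegral X]
    (f : X ⟶ Spec (.of F)) : F →+* X.functionField :=
  ((Scheme.ΓSpecIso (.of F)).inv ≫ f.appTop ≫ X.presheaf.germ ⊤ (genericPoint X) trivial).hom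

/-- For homomorphisms `φ : F → K` and `ι : E → K`, the image of
`ι` is the algebraic closure of `F` in `K`, that is, the set of all elements of `K` that are
algebraic over `F`. -/
def IsAlgClosureIn {F E K : Type u} [Field F] [Field E] [CommRing K]
    (φ : F →+* K) (ι : E →+* K) : Prop :=
  ∀ x : K, x ∈ ι.range ↔ letI := φ.toAlgebra; IsAlgebraic F x

/-- For an integral `k`-scheme `f : X ⟶ Spec k`: the field `k` is algebraically closed in `K(X)`. -/
def IsAlgClosedInFunctionField {k : Type u} [Field k] {X : Scheme.{u}} [IsIntegral X]
    (f : X ⟶ Spec (.of k)) : Prop :=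
  IsAlgClosureIn (toFunctionField f) (toFunctionField f)

/-! ### The field `k^{1/p}` -/

/-- The field `k^{1/p}`, inside an algebraic closure of `k`. -/
def rootField (k : Type u) [Field k] (p : ℕ) [Fact p.Prime] [CharP k p] :
    IntermediateField k (AlgebraicClosure k) where
  carrier := {x | ∃ a : k, algebraMap k (AlgebraicClosure k) a = x ^ p}
  mul_mem' := by
    rintro x y ⟨a, ha⟩ ⟨b, hb⟩
    exact ⟨a * b, by rw [map_mul, ha, hb, mul_pow]⟩
  add_mem' := by
    rintro x y ⟨a, ha⟩ ⟨b, hb⟩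
    have : CharP (AlgebraicClosure k) p := charP_of_injective_algebraMap
      (algebraMap k (AlgebraicClosure k)).injective p
    exact ⟨a + b, by rw [map_add, ha, hb, add_pow_char]⟩
  algebraMap_mem' a := ⟨a ^ p, map_pow _ _ _⟩
  inv_mem' := by
    rintro x ⟨a, ha⟩
    exact ⟨a⁻¹, by rw [map_inv₀, ha, inv_pow]⟩

instance isPurelyInseparable_rootField (k : Type u) [Field k] (p : ℕ) [Fact p.Prime] [CharP k p] :
    IsPurelyInseparable k (rootField k p) := by
  have : ExpChar k p := .prime (Fact.out)
  rw [isPurelyInseparable_iff_pow_mem k p]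
  rintro ⟨x, a, ha⟩
  exact ⟨1, a, Subtype.ext (by simpa using ha)⟩

/-! ### Elemental extensions -/

/-- Let `f : X ⟶ Spec k` be an integral scheme over a field `k` of characteristic `p > 0`, and let
`k ⊆ l ⊆ k'` be field extensions. The commutative diagram given by `φ : X' ⟶ X` and
`α' : X' ⟶ Spec k'` is an elemental extension of `(k, X)`. -/
structure IsElementalExtension (p : ℕ) {k l k' : Type u} [Field k] [Field l] [Field k']
    [Algebra k l] [Algebra l k'] [Algebra k k'] [IsScalarTower k l k']
    {X X' : Scheme.{u}} (f : X ⟶ Spec (.of k)) (φ : X' ⟶ X) (α' : X' ⟶ Spec (.of k')) :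
    Prop where
  isPurelyInseparable : IsPurelyInseparable k l
  pow_mem : ∀ x : l, x ^ p ∈ (algebraMap k l).range
  isIntegral_baseChange : IsIntegral (baseChange f l)
  /-- The structure morphisms of `X` and `X'` are compatible. -/
  comm : φ ≫ f = (α' ≫ specMap l k') ≫ specMap k l
  /-- The morphism `X' ⟶ X ×_k l` induced by `φ` is the normalisation; thus `φ` is the composite of
  the normalisation and the projection `X ×_k l ⟶ X`. -/
  isNormalisation : IsNormalisation
    (pullback.lift φ (α' ≫ specMap l k') comm : X' ⟶ baseChange f l)
  isIntegral : IsIntegral X'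
  /-- `k'` is the algebraic closure of `l` in `K(X')`. -/
  isAlgClosureIn : IsAlgClosureIn (toFunctionField (α' ≫ specMap l k')) (toFunctionField α')

/-- For an intermediate field `k ⊆ l ⊆ k^{1/p}`: the scheme `X ×_k l` is integral, and the algebraic
closure of `l` in `K(X ×_k l)` is equal to `k^{1/p}`, by way of an embedding of `k^{1/p}` in
`K(X ×_k l)` over `l` (there is at most one). -/
def IsRootClosure {k : Type u} [Field k] (p : ℕ) [Fact p.Prime] [CharP k p]
    {X : Scheme.{u}} (f : X ⟶ Spec (.of k)) (l : IntermediateField k (rootField k p)) : Prop :=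
  ∃ _ : IsIntegral (baseChange f l),
    ∃ ι : rootField k p →+* (baseChange f l).functionField,
      ι.comp (algebraMap l (rootField k p)) = toFunctionField (pullback.snd f (specMap k l)) ∧
      IsAlgClosureIn (toFunctionField (pullback.snd f (specMap k l))) ι

end

end Elemental

/-! Write K = K(X) and E = k^{1/p}, both embedded in an algebraic closure F of K. By Zorn, take l ⊂
E maximal among the fields for which K ⊗ l → F is injective. Since E^p ⊂ k, the image R is a field.
If a ∈ E were outside R, then X^p - a^p would be irreducible over R and l(a) would still be linearly
disjoint from K; so E ⊂ R (`IntermediateField.exists_isDisjointFrom_forall_mem_range`). Thus X ×_k l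
is reduced, hence integral, and its function field K ⊗ l contains E. An element of K(X ×_k l)
algebraic over l has p-th power in K algebraic over k, hence in k, so it lies in E
(`isAlgClosureIn_of_comp_eq`).

For any such l, the function field of (X ×_k E)_red is generated by K and E, both already inside K(X
×_k l). So (X ×_k E)_red → X ×_k l is integral and birational, and the two normalisations agree.

If X ×_k E is reduced, then K ⊗ E embeds in the function field of X ×_k E, and comparison with K ⊗ l
shows that any a ∈ E, being already in K(X ×_k l), lies in l. The converse is MacLane's criterion.
-/

/-! ### Tensor products of fields with extensions of height one. -/

section HeightOne

open scoped TensorProduct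

variable {k K E F : Type*} [Field k] [Field K] [Field E] [Field F] [Algebra k K] [Algebra k E]
  [Algebra k F] (p : ℕ) [Fact p.Prime] [CharP k p]

include p in
lemma TensorProduct.add_pow_char_of_field (x y : K ⊗[k] E) : (x + y) ^ p = x ^ p + y ^ p := by
  have : CharP (K ⊗[k] E) p :=
    charP_of_injective_algebraMap (algebraMap k (K ⊗[k] E)).injective p
  exact add_pow_char x y p

/-- If `E ^ p ⊆ k`, then the `p`-th powers of the elements of `K ⊗ E` lie in `K`. -/
lemma TensorProduct.exists_pow_eq_tmul_one (hE : ∀ x : E, x ^ p ∈ (algebraMap k E).range)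
    (t : K ⊗[k] E) : ∃ a : K, t ^ p = a ⊗ₜ 1 := by
  induction t with
  | zero => exact ⟨0, by simp [(Fact.out : p.Prime).ne_zero]⟩
  | tmul a b =>
    obtain ⟨c, hc⟩ := hE b
    exact ⟨c • a ^ p, by
      rw [Algebra.TensorProduct.tmul_pow, ← hc, Algebra.algebraMap_eq_smul_one,
        TensorProduct.tmul_smul, TensorProduct.smul_tmul']⟩
  | add x y hx hy =>
    obtain ⟨a, ha⟩ := hx
    obtain ⟨b, hb⟩ := hy
    exact ⟨a + b, by rw [TensorProduct.add_pow_char_of_field p, ha, hb, TensorProduct.add_tmul]⟩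

/-- The p-th power of a kernel element lies in the field K, on which the map is injective; so kernel
elements are nilpotent. -/
lemma TensorProduct.ringHom_injective_of_isReduced {S : Type*} [CommRing S] [Nontrivial S]
    (hE : ∀ x : E, x ^ p ∈ (algebraMap k E).range) [IsReduced (K ⊗[k] E)] (T : K ⊗[k] E →+* S) :
    Function.Injective T := by
  rw [injective_iff_map_eq_zero]
  intro t ht
  obtain ⟨a, ha⟩ := TensorProduct.exists_pow_eq_tmul_one p hE t
  have h0 : a = 0 := by
    have h : (T.comp Algebra.TensorProduct.includeLeftRingHom) a = 0 := by
      change T (a ⊗ₜ 1) = 0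
      rw [← ha, map_pow, ht, zero_pow (Fact.out : p.Prime).ne_zero]
    exact (map_eq_zero _).mp h
  rw [h0, TensorProduct.zero_tmul] at ha
  exact eq_zero_of_pow_eq_zero ha

/-- If `E ^ p ⊆ k`, the image of `K ⊗ E` in a field is a subfield. -/
def TensorProduct.rangeSubfield (hE : ∀ x : E, x ^ p ∈ (algebraMap k E).range)
    (T : K ⊗[k] E →+* F) : Subfield F :=
  { T.range with
    inv_mem' := by
      rintro _ ⟨t, rfl⟩
      obtain ⟨a, ha⟩ := TensorProduct.exists_pow_eq_tmul_one p hE t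
      have hT : T t ^ p = T (a ⊗ₜ 1) := by rw [← map_pow, ha]
      have h1 : T (a ⊗ₜ 1) * T (a⁻¹ ⊗ₜ 1) = 1 ∨ a = 0 := by
        rcases eq_or_ne a 0 with h | h
        · exact .inr h
        · left
          rw [← map_mul, Algebra.TensorProduct.tmul_mul_tmul, mul_inv_cancel₀ h, mul_one,
            ← Algebra.TensorProduct.one_def, map_one]
      have hp : p = (p - 1) + 1 := (Nat.succ_pred_prime Fact.out).symm
      refine ⟨t ^ (p - 1) * (a⁻¹ ⊗ₜ 1), ?_⟩
      rcases h1 with h1 | rfl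
      · refine (inv_eq_of_mul_eq_one_right ?_).symm
        rw [map_mul, map_pow, ← mul_assoc, ← pow_succ', ← hp, hT, h1]
      · have h0 : T t = 0 := by simpa [(Fact.out : p.Prime).ne_zero] using hT
        simp [h0] }

lemma TensorProduct.eq_zero_of_sum_tmul_eq_zero {V N ι : Type*} [AddCommGroup V] [Module k V]
    [AddCommGroup N] [Module k N] {v : ι → V} (hv : LinearIndependent k v) {s : Finset ι}
    {c : ι → N} (h : ∑ i ∈ s, v i ⊗ₜ[k] c i = 0) {i : ι} (hi : i ∈ s) : c i = 0 := by
  classical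
  let B := Module.Basis.sumExtend hv
  have h2 := congrArg (fun t => TensorProduct.lid k N ((B.coord (Sum.inl i)).rTensor N t)) h
  have hB (j : ι) : v j = B (Sum.inl j) := by
    simp only [B, Module.Basis.sumExtend, Module.Basis.reindex_apply, Module.Basis.extend_apply_self]
    rfl
  simpa [hB, Finsupp.single_apply, hi] using h2

/-- MacLane's criterion: if `K ⊗ E` is reduced and every element of `k` is a `p`-th power in `E`,
then `K` is geometrically reduced over `k`. -/
theorem TensorProduct.isReduced_of_isReduced_of_forall_exists_pow
    (hE : ∀ c : k, ∃ b : E, b ^ p = algebraMap k E c) [IsReduced (K ⊗[k] E)]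
    (E' : Type*) [Field E'] [Algebra k E'] : IsReduced (K ⊗[k] E') := by
  have hp : p.Prime := Fact.out
  let B := Module.Basis.ofVectorSpace k K
  -- A relation ∑ c_i B_i^p = 0 says that the p-th power of ∑ B_i ⊗ c_i^{1/p} vanishes in the
  -- reduced ring K ⊗ E.
  have hB : LinearIndependent k fun i => B i ^ p := by
    rw [linearIndependent_iff']
    intro s c hc i hi
    choose b hb using hE
    have h : (∑ i ∈ s, B i ⊗ₜ[k] b (c i)) ^ p = 0 := by
      have : CharP (K ⊗[k] E) p :=
        charP_of_injective_algebraMap (algebraMap k (K ⊗[k] E)).injective p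
      rw [sum_pow_char p]
      simp only [Algebra.TensorProduct.tmul_pow, hb, Algebra.algebraMap_eq_smul_one,
        TensorProduct.tmul_smul, TensorProduct.smul_tmul']
      rw [← TensorProduct.sum_tmul, hc, TensorProduct.zero_tmul]
    have h3 := hb (c i)
    rw [TensorProduct.eq_zero_of_sum_tmul_eq_zero (c := fun i => b (c i)) B.linearIndependent
      (eq_zero_of_pow_eq_zero h) hi, zero_pow hp.ne_zero] at h3
    exact (map_eq_zero _).mp h3.symm
  have key (t : K ⊗[k] E') (ht : t ^ p = 0) : t = 0 := by
    classical
    obtain ⟨c, rfl⟩ := (TensorProduct.equivFinsuppOfBasisLeft (N := E') B).symm.surjective t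
    rw [TensorProduct.equivFinsuppOfBasisLeft_symm_apply, Finsupp.sum] at ht ⊢
    have : CharP (K ⊗[k] E') p :=
      charP_of_injective_algebraMap (algebraMap k (K ⊗[k] E')).injective p
    rw [sum_pow_char p] at ht
    simp only [Algebra.TensorProduct.tmul_pow] at ht
    refine Finset.sum_eq_zero fun i hi => ?_
    rw [eq_zero_of_pow_eq_zero (TensorProduct.eq_zero_of_sum_tmul_eq_zero hB ht hi),
      TensorProduct.tmul_zero]
  refine ⟨fun t ⟨n, hn⟩ => ?_⟩
  have : ∀ m : ℕ, ∀ t : K ⊗[k] E', t ^ p ^ m = 0 → t = 0 := by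
    intro m
    induction m with
    | zero => simp
    | succ m ih => intro t ht; exact ih t (key _ (by rw [← pow_mul, ← pow_succ, ht]))
  refine this n t ?_
  -- As n < p^n, the relation t^n = 0 gives t^(p^n) = 0.
  rw [← Nat.sub_add_cancel (Nat.lt_pow_self hp.one_lt (n := n)).le, pow_add, hn, mul_zero]

/-! ### Maximal linearly disjoint subfields. -/

section LinearlyDisjoint

variable (φ : K →ₐ[k] F) (σ : E →ₐ[k] F)

/-- `K` and the intermediate field `l` of `E / k` are linearly disjoint in `F`. -/
def IntermediateField.IsDisjointFrom (l : IntermediateField k E) : Prop :=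
  Function.Injective (Algebra.TensorProduct.productMap φ (σ.comp l.val))

variable {φ σ}

/-- The coefficients are taken in E and only constrained to lie in l, so that relations over
different l can be compared. -/
lemma IntermediateField.isDisjointFrom_iff {ι : Type*} (B : Module.Basis ι k K)
    {l : IntermediateField k E} : l.IsDisjointFrom φ σ ↔
      ∀ c : ι →₀ E, (∀ i, c i ∈ l) → (c.sum fun i e => φ (B i) * σ e) = 0 → c = 0 := by
  classical
  have hsum (c : ι →₀ l) : Algebra.TensorProduct.productMap φ (σ.comp l.val)
      ((TensorProduct.equivFinsuppOfBasisLeft B).symm c) =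
        (c.mapRange (algebraMap l E) (map_zero _)).sum fun i e => φ (B i) * σ e := by
    rw [TensorProduct.equivFinsuppOfBasisLeft_symm_apply, Finsupp.sum_mapRange_index (by simp),
      Finsupp.sum, Finsupp.sum, map_sum]
    rfl
  constructor
  · intro h c hc h0
    let c' : ι →₀ l := Finsupp.onFinset c.support (fun i => ⟨c i, hc i⟩) (fun i hi => by
      simpa [Subtype.ext_iff] using hi)
    have hc' : c'.mapRange (algebraMap l E) (map_zero _) = c := by ext i; rfl
    rw [← hc', ← hsum] at h0
    have h1 := (injective_iff_map_eq_zero _).mp h _ h0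
    rw [LinearEquiv.map_eq_zero_iff] at h1
    rw [← hc', h1, Finsupp.mapRange_zero]
  · intro h
    refine (injective_iff_map_eq_zero _).mpr fun t ht => ?_
    obtain ⟨c, rfl⟩ := (TensorProduct.equivFinsuppOfBasisLeft (N := l) B).symm.surjective t
    rw [hsum] at ht
    have h1 := h _ (fun i => (c i).2) ht
    rw [LinearEquiv.map_eq_zero_iff]
    ext i
    exact congrArg (fun f => f i) h1

/-- Disjointness is a finitary condition: a relation over the union of a chain has finitely many
coefficients, so it already lives over one member. -/
lemma IntermediateField.exists_maximal_isDisjointFrom :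
    ∃ l : IntermediateField k E, Maximal (fun l => l.IsDisjointFrom φ σ) l := by
  let B := Module.Basis.ofVectorSpace k K
  have hbot : (⊥ : IntermediateField k E).IsDisjointFrom φ σ := by
    rw [IntermediateField.isDisjointFrom_iff B]
    intro c hc h0
    choose d hd using fun i => IntermediateField.mem_bot.mp (hc i)
    have hli : LinearIndependent k (φ ∘ B) :=
      B.linearIndependent.map' φ.toLinearMap (LinearMap.ker_eq_bot.mpr φ.toRingHom.injective)
    rw [linearIndependent_iff'] at hli
    have h1 := hli c.support d (by
      rw [← h0, Finsupp.sum]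
      refine Finset.sum_congr rfl fun i _ => ?_
      rw [← hd, AlgHom.commutes, Algebra.smul_def, mul_comm]; rfl)
    ext i
    by_contra hi
    exact hi (by rw [← hd, h1 i (by simpa using hi), map_zero]; rfl)
  obtain ⟨l, -, hl⟩ := zorn_le_nonempty₀ {l : IntermediateField k E | l.IsDisjointFrom φ σ}
    (fun C hC hchain y hy => by
      refine ⟨sSup C, ?_, fun z hz => le_sSup hz⟩
      have hne : Nonempty C := ⟨⟨y, hy⟩⟩
      have hdir : Directed (· ≤ ·) (fun i : C => (i : IntermediateField k E)) :=
        hchain.directed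
      change (sSup C).IsDisjointFrom φ σ
      rw [IntermediateField.isDisjointFrom_iff B]
      intro c hc h0
      have hmem (i) : ∃ m : C, c i ∈ (m : IntermediateField k E) := by
        have := hc i
        rw [sSup_eq_iSup', ← SetLike.mem_coe, IntermediateField.coe_iSup_of_directed hdir] at this
        simpa using this
      choose m hm using hmem
      classical
      obtain ⟨z, hz⟩ := hdir.finset_le (c.support.image m)
      refine (IntermediateField.isDisjointFrom_iff B).mp (hC z.2) c (fun i => ?_) h0
      by_cases hi : c i = 0
      · rw [hi]; exact zero_mem _
      · exact hz (m i) (Finset.mem_image_of_mem _ (by simpa using hi)) (hm i))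
    ⊥ hbot
  exact ⟨l, hl⟩

/-- If `E ^ p ⊆ k`, then there is an intermediate field `l` of `E / k` that is linearly disjoint
from `K` in `F` and such that the compositum of `K` and `l` contains `E`. -/
theorem IntermediateField.exists_isDisjointFrom_forall_mem_range
    (hE : ∀ x : E, x ^ p ∈ (algebraMap k E).range) :
    ∃ l : IntermediateField k E, l.IsDisjointFrom φ σ ∧
      ∀ x : E, ∃ t, Algebra.TensorProduct.productMap φ (σ.comp l.val) t = σ x := by
  classical
  have hp : p.Prime := Fact.out
  have : CharP F p := charP_of_injective_algebraMap (algebraMap k F).injective p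
  obtain ⟨l, hl⟩ := IntermediateField.exists_maximal_isDisjointFrom (φ := φ) (σ := σ)
  refine ⟨l, hl.prop, ?_⟩
  by_contra! hcon
  obtain ⟨a, ha⟩ := hcon
  have hlE (x : l) : x ^ p ∈ (algebraMap k l).range := by
    obtain ⟨c, hc⟩ := hE x
    exact ⟨c, Subtype.ext hc⟩
  let R := TensorProduct.rangeSubfield p hlE
    (Algebra.TensorProduct.productMap φ (σ.comp l.val)).toRingHom
  have haR : σ a ∉ R := fun ⟨t, ht⟩ => ha t ht
  have hφR (x : K) : φ x ∈ R := ⟨x ⊗ₜ 1, by simp⟩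
  have hσR (x : l) : σ x ∈ R := ⟨1 ⊗ₜ x, by simp⟩
  obtain ⟨c₀, hc₀⟩ := hE a
  have hr : σ a ^ p ∈ R := by
    rw [← map_pow, ← hc₀]; exact hσR (algebraMap k l c₀)
  let g : Polynomial R := .X ^ p - .C ⟨σ a ^ p, hr⟩
  -- By injectivity of Frobenius on F, a p-th root of `σ a ^ p` in `R` would be `σ a` itself.
  have hg : Irreducible g := X_pow_sub_C_irreducible_of_prime hp fun b hb => haR (by
    have h1 : (b : F) ^ p = σ a ^ p := congrArg Subtype.val hb
    rw [← frobenius_inj F p h1]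
    exact b.2)
  have hgm : minpoly R (σ a) = g :=
    (minpoly.eq_of_irreducible_of_monic hg (by simp [g, sub_eq_zero]; rfl)
      (Polynomial.monic_X_pow_sub_C _ hp.ne_zero)).symm
  let B := Module.Basis.ofVectorSpace k K
  let l' : IntermediateField k E := (IntermediateField.adjoin l {a}).restrictScalars k
  have hal' : a ∈ l' := IntermediateField.mem_adjoin_simple_self l a
  have hll' : l ≤ l' := fun x hx => (IntermediateField.adjoin l {a}).algebraMap_mem ⟨x, hx⟩
  -- Disjointness of l(a) contradicts maximality, which would put a in l.
  suffices h : l'.IsDisjointFrom φ σ from haR (hσR ⟨a, hl.le_of_ge h hll' hal'⟩)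
  rw [IntermediateField.isDisjointFrom_iff B]
  intro c hc h0
  have hint : (Polynomial.X ^ p - .C (algebraMap k l c₀) : Polynomial l).aeval a = 0 := by
    simp only [map_sub, map_pow, Polynomial.aeval_X, Polynomial.aeval_C, ← hc₀, sub_eq_zero]
    rfl
  have hmon := Polynomial.monic_X_pow_sub_C (algebraMap k l c₀) hp.ne_zero
  -- The last clause keeps the coefficient families of the `q i` supported on `c.support`.
  have hq (i) : ∃ q : Polynomial l, q.aeval a = c i ∧ q.degree < p ∧ (c i = 0 → q = 0) := by
    by_cases hi : c i = 0
    · exact ⟨0, by simp [hi], by simp, fun _ => rfl⟩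
    · have h1 : c i ∈ IntermediateField.adjoin l {a} := hc i
      rw [← IntermediateField.mem_toSubalgebra,
        IntermediateField.adjoin_simple_toSubalgebra_of_isAlgebraic
          (IsIntegral.isAlgebraic ⟨_, hmon, hint⟩), Algebra.adjoin_singleton_eq_range_aeval] at h1
      obtain ⟨q, hq⟩ := h1
      refine ⟨q %ₘ (.X ^ p - .C (algebraMap k l c₀)), ?_, ?_, fun h => (hi h).elim⟩
      · rw [Polynomial.aeval_modByMonic_eq_self_of_root hint, ← hq]; rfl
      · exact (Polynomial.degree_modByMonic_lt _ hmon).trans_eq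
          (Polynomial.degree_X_pow_sub_C hp.pos _)
  choose q hqa hqd hq0 using hq
  let τ : l →+* R := (σ.toRingHom.comp (algebraMap l E)).codRestrict R fun x => hσR x
  -- The relation reads Q(σ a) = 0 with deg Q < p, the degree of the minimal polynomial; hence Q =
  -- 0.
  let Q : Polynomial R := ∑ i ∈ c.support, .C ⟨φ (B i), hφR _⟩ * (q i).map τ
  have hQa : Q.aeval (σ a) = 0 := by
    rw [← h0, map_sum, Finsupp.sum]
    refine Finset.sum_congr rfl fun i _ => ?_
    rw [map_mul, Polynomial.aeval_C, ← hqa, Polynomial.aeval_def, Polynomial.eval₂_map,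
      Polynomial.aeval_def]
    erw [Polynomial.hom_eval₂]
    rfl
  have hQ : Q = 0 := by
    by_contra hne
    have h1 := minpoly.degree_le_of_ne_zero R (σ a) hne hQa
    rw [hgm, Polynomial.degree_X_pow_sub_C hp.pos] at h1
    refine absurd h1 (not_le.mpr ?_)
    refine (Polynomial.degree_sum_le _ _).trans_lt
      ((Finset.sup_lt_iff (WithBot.bot_lt_coe p)).mpr fun i _ => ?_)
    exact (((Polynomial.degree_mul_le _ _).trans (add_le_add Polynomial.degree_C_le
      Polynomial.degree_map_le)).trans_eq (zero_add _)).trans_lt (hqd i)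
  -- The j-th coefficient of Q = 0 is a relation with coefficients in l, where disjointness is
  -- known.
  have hqz (i j) : (q i).coeff j = 0 := by
    let d : _ →₀ E := Finsupp.onFinset c.support (fun i => ((q i).coeff j : E)) fun i hi => by
      contrapose! hi
      simp [hq0 i (by simpa using hi)]
    have hd : d = 0 := by
      refine (IntermediateField.isDisjointFrom_iff B).mp hl.prop d (fun i => ((q i).coeff j).2) ?_
      rw [Finsupp.onFinset_sum _ (by simp)]
      have := congrArg (fun f : Polynomial R => (f.coeff j : F)) hQ
      simp only [Q, Polynomial.finsetSum_coeff, Polynomial.coeff_C_mul, Polynomial.coeff_map,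
        Polynomial.coeff_zero] at this
      push_cast at this
      exact this
    exact Subtype.ext (congrArg (fun f => f i) hd)
  ext i
  rw [← hqa i, show q i = 0 from Polynomial.ext (hqz i)]
  simp

end LinearlyDisjoint

end HeightOne

/-! ### Function fields and dominant morphisms. -/

namespace AlgebraicGeometry

noncomputable section FunctionFieldMap

variable {X Y Z : Scheme.{u}} [IsIntegral X] [IsIntegral Y] [IsIntegral Z]

lemma Scheme.Hom.apply_genericPoint_of_isDominant (g : Y ⟶ X) [IsDominant g] :
    g (genericPoint Y) = genericPoint X := by
  refine IsGenericPoint.eq ?_ (genericPoint_spec X)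
  have := (genericPoint_spec Y).image g.continuous
  rwa [Set.image_univ, g.denseRange.closure_eq] at this

/-- The embedding of function fields `K(X) ⟶ K(Y)` of a dominant morphism `Y ⟶ X`. -/
def Scheme.Hom.functionFieldMap (g : Y ⟶ X) [IsDominant g] :
    X.functionField ⟶ Y.functionField :=
  X.presheaf.stalkSpecializes
    (Inseparable.of_eq g.apply_genericPoint_of_isDominant).specializes ≫ g.stalkMap (genericPoint Y)

lemma Scheme.Hom.germ_functionFieldMap (g : Y ⟶ X) [IsDominant g] (U : X.Opens)
    (hX : genericPoint X ∈ U) (hY : genericPoint Y ∈ g ⁻¹ᵁ U) :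
    X.presheaf.germ U (genericPoint X) hX ≫ g.functionFieldMap =
      g.app U ≫ Y.presheaf.germ (g ⁻¹ᵁ U) (genericPoint Y) hY := by
  simp [functionFieldMap]

lemma Scheme.Hom.SpecMap_functionFieldMap_fromSpecStalk (g : Y ⟶ X) [IsDominant g] :
    Spec.map g.functionFieldMap ≫ X.fromSpecStalk (genericPoint X) =
      Y.fromSpecStalk (genericPoint Y) ≫ g := by
  simp [functionFieldMap, Spec.map_comp]

lemma functionField_hom_ext {R : CommRingCat.{u}} {a b : X.functionField ⟶ R}
    (h : ∀ (U : X.Opens) (hU : genericPoint X ∈ U),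
      X.presheaf.germ U _ hU ≫ a = X.presheaf.germ U _ hU ≫ b) : a = b :=
  TopCat.Presheaf.stalk_hom_ext _ h

lemma Scheme.Hom.functionFieldMap_comp (h : Z ⟶ Y) (g : Y ⟶ X) [IsDominant h] [IsDominant g] :
    (h ≫ g).functionFieldMap = g.functionFieldMap ≫ h.functionFieldMap := by
  refine functionField_hom_ext fun U hU => ?_
  have hY : genericPoint Y ∈ g ⁻¹ᵁ U := by
    change g _ ∈ U; rwa [g.apply_genericPoint_of_isDominant]
  have hZ : genericPoint Z ∈ h ⁻¹ᵁ (g ⁻¹ᵁ U) := by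
    change h _ ∈ g ⁻¹ᵁ U; rwa [h.apply_genericPoint_of_isDominant]
  rw [reassoc_of% germ_functionFieldMap g U hU hY, germ_functionFieldMap h _ hY hZ,
    germ_functionFieldMap _ U hU hZ, comp_app_assoc]
  rfl

instance isDominant_fromSpecStalk_genericPoint : IsDominant (X.fromSpecStalk (genericPoint X)) := by
  refine ⟨dense_iff_closure_eq.mpr (Set.univ_subset_iff.mp ?_)⟩
  rw [← (genericPoint_spec X).def]
  refine closure_mono (Set.singleton_subset_iff.mpr ?_)
  exact ⟨IsLocalRing.closedPoint _, Scheme.fromSpecStalk_closedPoint⟩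

end FunctionFieldMap

end AlgebraicGeometry

/-! ### Structure morphisms, normalisation and function fields. -/

namespace Elemental

noncomputable section

variable {X Y : Scheme.{u}} [IsIntegral X] [IsIntegral Y]

lemma toFunctionField_comp {k : Type u} [Field k] (f : X ⟶ Spec (.of k)) (g : Y ⟶ X)
    [IsDominant g] :
    toFunctionField (g ≫ f) = g.functionFieldMap.hom.comp (toFunctionField f) := by
  rw [toFunctionField, toFunctionField, ← CommRingCat.hom_comp]
  congr 1
  simp only [Category.assoc, Scheme.Hom.comp_appTop]
  rw [g.germ_functionFieldMap ⊤ trivial trivial]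
  rfl

lemma toFunctionField_specMap_comp {k l : Type u} [Field k] [Field l] [Algebra k l]
    (f : X ⟶ Spec (.of l)) :
    toFunctionField (f ≫ specMap k l) = (toFunctionField f).comp (algebraMap k l) := by
  change _ = (toFunctionField f).comp (CommRingCat.ofHom (algebraMap k l)).hom
  rw [toFunctionField, toFunctionField, ← CommRingCat.hom_comp]
  congr 1
  simp only [Scheme.Hom.comp_appTop, ← Category.assoc]
  congr 2
  exact (Scheme.ΓSpecIso_inv_naturality (CommRingCat.ofHom (algebraMap k l))).symm

instance isDominant_fromNormalisation : IsDominant (fromNormalisation Y) := by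
  have : IsDominant ((fromSpecFunctionField Y).toNormalization ≫ fromNormalisation Y) := by
    rw [Scheme.Hom.toNormalization_fromNormalization]; infer_instance
  exact .of_comp (fromSpecFunctionField Y).toNormalization _

lemma surjective_functionFieldMap_of_stalkMap (g : Y ⟶ X) [IsDominant g]
    (h : Function.Surjective (g.stalkMap (genericPoint Y))) :
    Function.Surjective g.functionFieldMap.hom := by
  have h1 : IsIso (X.presheaf.stalkSpecializes
      (Inseparable.of_eq g.apply_genericPoint_of_isDominant).specializes) :=
    (X.presheaf.stalkCongr (Inseparable.of_eq g.apply_genericPoint_of_isDominant)).isIso_inv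
  exact h.comp (ConcreteCategory.bijective_of_isIso (X.presheaf.stalkSpecializes
      (Inseparable.of_eq g.apply_genericPoint_of_isDominant).specializes)).2

/-- The composite Spec K(Y) → Y^N → Y is a preimmersion, so K(Y) → K(Y^N) → K(Spec K(Y)) is
surjective; as the second map is injective, the first is surjective. -/
lemma bijective_functionFieldMap_fromNormalisation :
    Function.Bijective (fromNormalisation Y).functionFieldMap.hom := by
  refine ⟨RingHom.injective _, fun x => ?_⟩
  let t := (fromSpecFunctionField Y).toNormalization
  have hs : Function.Surjective (t ≫ fromNormalisation Y).functionFieldMap.hom := by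
    refine surjective_functionFieldMap_of_stalkMap _ ?_
    have : IsPreimmersion (t ≫ fromNormalisation Y) := by
      rw [Scheme.Hom.toNormalization_fromNormalization]; infer_instance
    exact Scheme.Hom.stalkMap_surjective _ _
  obtain ⟨z, hz⟩ := hs (t.functionFieldMap.hom x)
  refine ⟨z, t.functionFieldMap.hom.injective ?_⟩
  rw [← hz, Scheme.Hom.functionFieldMap_comp]
  rfl

/-- If `g : Y ⟶ X` is integral and birational, then the normalisation of `Y` is that of `X`. -/
lemma isNormalisation_fromNormalisation_comp (g : Y ⟶ X) [IsDominant g] [IsIntegralHom g]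
    (hg : Function.Bijective g.functionFieldMap.hom) :
    IsNormalisation (fromNormalisation Y ≫ g) := by
  let nX := fromSpecFunctionField X
  let nY := fromSpecFunctionField Y
  have : IsIso g.functionFieldMap := (ConcreteCategory.isIso_iff_bijective _).mpr hg
  let s := Spec.map g.functionFieldMap
  have hs : s ≫ nX = nY ≫ g := g.SpecMap_functionFieldMap_fromSpecStalk
  -- X^N ×_X Y is integral over Y and receives Spec K(Y), so the universal property of Y^N applies.
  let a : nY.normalization ⟶ nX.normalization :=
    nY.normalizationDesc (pullback.lift (s ≫ nX.toNormalization) nY (by simp [hs]))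
      (pullback.snd nX.fromNormalization g) (pullback.lift_snd _ _ _).symm ≫ pullback.fst _ _
  have ha₁ : nY.toNormalization ≫ a = s ≫ nX.toNormalization := by
    simp only [a, Scheme.Hom.toNormalization_normalizationDesc_assoc]
    exact pullback.lift_fst _ _ _
  have ha₂ : a ≫ nX.fromNormalization = nY.fromNormalization ≫ g := by
    simp only [a, Category.assoc, pullback.condition]
    rw [Scheme.Hom.normalizationDesc_comp_assoc]
  -- Conversely, Y^N → Y → X is integral and receives Spec K(X) ≅ Spec K(Y).
  let b : nX.normalization ⟶ nY.normalization :=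
    nX.normalizationDesc (inv s ≫ nY.toNormalization) (nY.fromNormalization ≫ g) (by
      simp [← hs])
  have hb₁ : nX.toNormalization ≫ b = inv s ≫ nY.toNormalization := by simp [b]
  have hb₂ : b ≫ nY.fromNormalization ≫ g = nX.fromNormalization := by
    simp only [b]; rw [Scheme.Hom.normalizationDesc_comp]
  refine ⟨⟨a, b, ?_, ?_⟩, ha₂⟩
  · refine ext_of_isDominant_of_isSeparated (nY.fromNormalization ≫ g) ?_ nY.toNormalization ?_
    · simp [hb₂, ha₂]
    · simp [reassoc_of% ha₁, hb₁]
  · refine ext_of_isDominant_of_isSeparated nX.fromNormalization ?_ nX.toNormalization ?_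
    · simp [hb₂, ha₂]
    · simp [reassoc_of% hb₁, ha₁]

end

end Elemental

open scoped TensorProduct

/-! ### Reducedness of a base change, read off the generic fibre. -/

namespace Elemental

noncomputable section

/-- The function field of an integral `k`-scheme, as an algebra over `k`. -/
abbrev functionFieldAlgebra {k : Type u} [Field k] {X : Scheme.{u}} [IsIntegral X]
    (f : X ⟶ Spec (.of k)) : Algebra k X.functionField :=
  (toFunctionField f).toAlgebra

instance flat_fromSpecFunctionField (X : Scheme.{u}) [IsIntegral X] :
    Flat (fromSpecFunctionField X) := by
  obtain ⟨_, ⟨U, hU, rfl⟩, hxU, -⟩ := X.isBasis_affineOpens.exists_subset_of_mem_open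
    (Set.mem_univ (genericPoint X)) isOpen_univ
  have : Nonempty U := ⟨⟨_, hxU⟩⟩
  have := functionField_isFractionRing_of_isAffineOpen X U hU
  have h1 : (X.presheaf.germ U _ hxU).hom.Flat :=
    IsLocalization.flat X.functionField (nonZeroDivisors Γ(X, U))
  have : Flat (Spec.map (X.presheaf.germ U _ hxU)) := Flat.SpecMap_iff.mpr h1
  rw [fromSpecFunctionField, ← hU.fromSpecStalk_eq_fromSpecStalk hxU]
  have h2 : IsOpenImmersion hU.fromSpec := hU.isOpenImmersion_fromSpec
  exact MorphismProperty.comp_mem @Flat _ hU.fromSpec this (inferInstanceAs (Flat _))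

/-- The stalk maps are surjective, and faithfully flat hence injective; so they are isomorphisms. -/
lemma isReduced_of_flat_of_isPreimmersion {X Y : Scheme.{u}} (g : Y ⟶ X) [Flat g]
    [IsPreimmersion g] [IsReduced X] : IsReduced Y := by
  have (y : Y) : _root_.IsReduced (Y.presheaf.stalk y) := by
    have h : Function.Injective (g.stalkMap y).hom := by
      algebraize [(g.stalkMap y).hom]
      have : Module.Flat (X.presheaf.stalk (g y)) (Y.presheaf.stalk y) := Flat.stalkMap g y
      have : IsLocalHom (algebraMap (X.presheaf.stalk (g y)) (Y.presheaf.stalk y)) :=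
        inferInstanceAs (IsLocalHom (g.stalkMap y).hom)
      have : Module.FaithfullyFlat (X.presheaf.stalk (g y)) (Y.presheaf.stalk y) :=
        Module.FaithfullyFlat.of_flat_of_isLocalHom
      exact FaithfulSMul.algebraMap_injective (X.presheaf.stalk (g y)) (Y.presheaf.stalk y)
    let e := RingEquiv.ofBijective (g.stalkMap y).hom ⟨h, g.stalkMap_surjective y⟩
    exact isReduced_of_injective e.symm.toRingHom e.symm.injective
  exact isReduced_of_isReduced_stalk _

section

variable {k : Type u} [Field k] {X : Scheme.{u}} [IsIntegral X] (f : X ⟶ Spec (.of k))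
  (E : Type u) [Field E] [Algebra k E]

lemma fromSpecFunctionField_comp :
    fromSpecFunctionField X ≫ f = Spec.map (CommRingCat.ofHom (toFunctionField f)) := by
  rw [toFunctionField, CommRingCat.ofHom_hom, Spec.map_comp, Spec.map_comp,
    ← Scheme.fromSpecStalk_toSpecΓ, Category.assoc, Category.assoc]
  erw [← Scheme.toSpecΓ_naturality_assoc]
  rw [← SpecMap_ΓSpecIso_hom, ← Spec.map_comp, Iso.inv_hom_id, Spec.map_id, Category.comp_id]

instance flat_specMap : Flat (specMap k E) := by
  refine Flat.SpecMap_iff.mpr ?_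
  change (algebraMap k E).Flat
  rw [RingHom.flat_algebraMap_iff]
  infer_instance

omit [IsIntegral X] in
lemma exists_isPullback_Spec_tensorProduct {K : Type u} [Field K] [Algebra k K]
    (η : Spec (.of K) ⟶ X) (hη : η ≫ f = specMap k K) :
    ∃ (v : Spec (.of (K ⊗[k] E)) ⟶ baseChange f E) (w : Spec (.of (K ⊗[k] E)) ⟶ Spec (.of K)),
      IsPullback v w (pullback.fst f (specMap k E)) η := by
  have h1 : IsPullback (Spec.map (CommRingCat.ofHom Algebra.TensorProduct.includeLeftRingHom :
      .of K ⟶ .of (K ⊗[k] E)))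
      (Spec.map (CommRingCat.ofHom (Algebra.TensorProduct.includeRight.toRingHom :
        E →+* K ⊗[k] E))) (η ≫ f) (specMap k E) := by
    rw [hη]
    exact isPullback_SpecMap_of_isPushout _ _ _ _ (CommRingCat.isPushout_tensorProduct k K E)
  let v : Spec (.of (K ⊗[k] E)) ⟶ baseChange f E :=
    pullback.lift (Spec.map (CommRingCat.ofHom Algebra.TensorProduct.includeLeftRingHom) ≫ η) _
      (by simpa using h1.w)
  have hv : v ≫ pullback.snd f (specMap k E) = _ := pullback.lift_snd _ _ _
  have hv' : v ≫ pullback.fst f (specMap k E) = _ := pullback.lift_fst _ _ _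
  refine ⟨v, _, .of_right (h₁₂ := pullback.snd f (specMap k E)) (h₂₂ := f) ?_ hv'
    (IsPullback.of_hasPullback f (specMap k E)).flip⟩
  rw [hv]
  exact h1.flip

/-- Spec(K(X) ⊗ E) → X ×_k E is the base change of Spec K(X) → X. It is a flat preimmersion, which
carries reducedness up; it is also scheme-theoretically dominant, which carries it down. -/
lemma isReduced_baseChange_iff :
    letI := functionFieldAlgebra f
    IsReduced (baseChange f E) ↔ _root_.IsReduced (X.functionField ⊗[k] E) := by
  let := functionFieldAlgebra f
  obtain ⟨v, w, h⟩ := exists_isPullback_Spec_tensorProduct f E (K := X.functionField)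
    (fromSpecFunctionField X) (fromSpecFunctionField_comp f)
  have hQ := quasiCompact_fromSpecFunctionField X
  constructor
  · intro hr
    have : Flat v := MorphismProperty.of_isPullback h.flip (flat_fromSpecFunctionField X)
    have : IsPreimmersion v := MorphismProperty.of_isPullback h.flip
      (inferInstance : IsPreimmersion (fromSpecFunctionField X))
    have := isReduced_of_flat_of_isPreimmersion v
    exact (affine_isReduced_iff (.of (X.functionField ⊗[k] E))).mp this
  · intro hr
    have : IsReduced (Spec (.of (X.functionField ⊗[k] E))) := (affine_isReduced_iff _).mpr hr
    have : IsSchemeTheoreticallyDominant (fromSpecFunctionField X) := .of_isDominant _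
    have : IsSchemeTheoreticallyDominant v := .of_isPullback h.flip
    have : QuasiCompact v := MorphismProperty.of_isPullback h.flip hQ
    exact IsSchemeTheoreticallyDominant.isReduced v

end

/-! ### Generators of the function field of a closed subscheme of X ×_k E. -/

lemma range_eq_top_of_isPushout {A B C P : CommRingCat.{u}} {a : A ⟶ B} {b : A ⟶ C} {i : B ⟶ P}
    {j : C ⟶ P} (h : IsPushout a b i j) (S : Subring P) (hi : ∀ x, i x ∈ S) (hj : ∀ x, j x ∈ S)
    (x : P) : x ∈ S := by
  let i' : B ⟶ .of S := CommRingCat.ofHom (i.hom.codRestrict S hi)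
  let j' : C ⟶ .of S := CommRingCat.ofHom (j.hom.codRestrict S hj)
  have hi' : i' ≫ CommRingCat.ofHom S.subtype = i := rfl
  have hj' : j' ≫ CommRingCat.ofHom S.subtype = j := rfl
  have hw : a ≫ i' = b ≫ j' := by
    refine CommRingCat.hom_ext (RingHom.ext fun x => Subtype.ext ?_)
    change (a ≫ i).hom x = (b ≫ j).hom x
    rw [h.w]
  have hid : h.desc i' j' hw ≫ CommRingCat.ofHom S.subtype = 𝟙 P :=
    h.hom_ext (by simp [hi']) (by simp [hj'])
  have := congrArg (fun g => g.hom x) hid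
  change ((h.desc i' j' hw x : S) : P) = x at this
  rw [← this]
  exact Subtype.prop _

section

variable {k : Type u} [Field k] {X : Scheme.{u}} [IsIntegral X] (f : X ⟶ Spec (.of k))
  (E : Type u) [Field E] [Algebra k E]

omit [IsIntegral X] in
lemma isPushout_app_pullback {U : X.Opens} (hU : IsAffineOpen U) :
    IsPushout (f.appLE ⊤ U le_top) ((specMap k E).appLE ⊤ ⊤ le_top)
      ((pullback.fst f (specMap k E)).app U)
      ((pullback.snd f (specMap k E)).appLE ⊤ (pullback.fst f (specMap k E) ⁻¹ᵁ U) le_top) := by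
  have h := (isIso_pushoutSection_iff (IsPullback.of_hasPullback f (specMap k E)) (US := ⊤)
    (UT := ⊤) (UX := U) le_top le_top (UY := pullback.fst f (specMap k E) ⁻¹ᵁ U)
    (by simp)).mp (isIso_pushoutSection_of_isAffineOpen _ _ _ _ (isAffineOpen_top _)
      (isAffineOpen_top _) hU)
  rwa [← Scheme.Hom.app_eq_appLE] at h

omit [IsIntegral X] in
lemma appLE_app_germ_eq_appTop_germ {Y Z : Scheme.{u}} (r : X ⟶ Y) (j : Z ⟶ X) {V : X.Opens} {z : Z}
    (e : V ≤ r ⁻¹ᵁ ⊤) (hz : z ∈ j ⁻¹ᵁ V) :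
    r.appLE ⊤ V e ≫ j.app V ≫ Z.presheaf.germ (j ⁻¹ᵁ V) z hz =
      (j ≫ r).appTop ≫ Z.presheaf.germ ⊤ z trivial := by
  rw [Scheme.Hom.app_eq_appLE, Scheme.Hom.appLE_comp_appLE_assoc, Scheme.Hom.appLE, Category.assoc,
    TopCat.Presheaf.germ_res]
  rfl

/-- The function field of an integral closed subscheme `Y` of `X ×_k E` dominating `X` is generated
by `K(X)` and `E`. -/
lemma eq_top_of_range_functionFieldMap_le {Y : Scheme.{u}} [IsIntegral Y] (j : Y ⟶ baseChange f E)
    [IsClosedImmersion j] [IsDominant (j ≫ pullback.fst f (specMap k E))]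
    (S : Subfield Y.functionField)
    (hX : ∀ x, (j ≫ pullback.fst f (specMap k E)).functionFieldMap.hom x ∈ S)
    (hE : ∀ x, toFunctionField (j ≫ pullback.snd f (specMap k E)) x ∈ S) : S = ⊤ := by
  let q := pullback.fst f (specMap k E)
  obtain ⟨_, ⟨U, hU, rfl⟩, hxU, -⟩ := X.isBasis_affineOpens.exists_subset_of_mem_open
    (Set.mem_univ (genericPoint X)) isOpen_univ
  have hq : IsAffineHom q := by
    have h : IsAffineHom (specMap k E) := inferInstance
    exact MorphismProperty.of_isPullback (IsPullback.of_hasPullback f (specMap k E)).flip h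
  have hqU : IsAffineOpen (q ⁻¹ᵁ U) := hU.preimage q
  have hV : IsAffineOpen (j ⁻¹ᵁ q ⁻¹ᵁ U) := hqU.preimage j
  have hyV : genericPoint Y ∈ j ⁻¹ᵁ q ⁻¹ᵁ U := by
    change (j ≫ q) _ ∈ U
    rwa [Scheme.Hom.apply_genericPoint_of_isDominant]
  have : Nonempty (j ⁻¹ᵁ q ⁻¹ᵁ U : Y.Opens) := ⟨⟨_, hyV⟩⟩
  have := functionField_isFractionRing_of_isAffineOpen Y _ hV
  -- Over an affine U, the sections of X ×_k E are generated by Γ(X, U) and E. They surject onto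
  -- those of Y, whose fractions exhaust K(Y).
  have hmem (t : Γ(baseChange f E, q ⁻¹ᵁ U)) :
      (j.app (q ⁻¹ᵁ U) ≫ Y.presheaf.germ (j ⁻¹ᵁ q ⁻¹ᵁ U) (genericPoint Y) hyV) t ∈ S := by
    refine range_eq_top_of_isPushout (isPushout_app_pullback f E hU) (S.toSubring.comap
      (j.app (q ⁻¹ᵁ U) ≫ Y.presheaf.germ (j ⁻¹ᵁ q ⁻¹ᵁ U) (genericPoint Y) hyV).hom) ?_ ?_ t
    · intro x
      have h : X.presheaf.germ U _ hxU ≫ (j ≫ q).functionFieldMap = q.app U ≫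
          j.app (q ⁻¹ᵁ U) ≫ Y.presheaf.germ (j ⁻¹ᵁ q ⁻¹ᵁ U) (genericPoint Y) hyV := by
        rw [(j ≫ q).germ_functionFieldMap U hxU hyV, Scheme.Hom.comp_app]
        exact Category.assoc _ _ _
      have h' := hX (X.presheaf.germ U _ hxU x)
      change (X.presheaf.germ U _ hxU ≫ (j ≫ q).functionFieldMap).hom x ∈ S at h'
      rwa [h] at h'
    · intro x
      let r := pullback.snd f (specMap k E)
      have h : r.appLE ⊤ (q ⁻¹ᵁ U) le_top ≫ j.app (q ⁻¹ᵁ U) ≫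
          Y.presheaf.germ (j ⁻¹ᵁ q ⁻¹ᵁ U) (genericPoint Y) hyV =
          (Scheme.ΓSpecIso (.of E)).hom ≫ CommRingCat.ofHom (toFunctionField (j ≫ r)) := by
        rw [toFunctionField, CommRingCat.ofHom_hom, Iso.hom_inv_id_assoc]
        exact appLE_app_germ_eq_appTop_germ r j _ _
      have h' := hE ((Scheme.ΓSpecIso (.of E)).hom x)
      change ((Scheme.ΓSpecIso (.of E)).hom ≫
        CommRingCat.ofHom (toFunctionField (j ≫ r))).hom x ∈ S at h'
      rwa [← h] at h'
  refine top_unique fun y _ => ?_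
  obtain ⟨a, b, -, rfl⟩ := IsFractionRing.div_surjective (A := Γ(Y, j ⁻¹ᵁ q ⁻¹ᵁ U)) y
  obtain ⟨a, rfl⟩ := j.app_surjective _ hqU a
  obtain ⟨b, rfl⟩ := j.app_surjective _ hqU b
  exact S.div_mem (hmem a) (hmem b)

end

end

end Elemental

section

variable {k K E L : Type*} [Field k] [Field K] [Field E] [Algebra k K] [Algebra k E]

lemma TensorProduct.exists_ringHom_tmul_eq_mul [CommRing L] (a : K →+* L) (b : E →+* L)
    (h : a.comp (algebraMap k K) = b.comp (algebraMap k E)) :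
    ∃ T : K ⊗[k] E →+* L, ∀ x y, T (x ⊗ₜ y) = a x * b y := by
  let := (a.comp (algebraMap k K)).toAlgebra
  let a' : K →ₐ[k] L := { a with commutes' := fun _ => rfl }
  let b' : E →ₐ[k] L := { b with commutes' := fun x => (congrArg (fun g => g x) h).symm }
  exact ⟨(Algebra.TensorProduct.productMap a' b').toRingHom, fun x y => by
    simp [a', b']⟩

/-- A k-linear retraction K → k sends K ⊗ l into l and 1 ⊗ a to a. -/
lemma IntermediateField.mem_of_map_val_eq_one_tmul {l : IntermediateField k E} {t : K ⊗[k] l}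
    {a : E} (h : Algebra.TensorProduct.map (AlgHom.id k K) l.val t = 1 ⊗ₜ a) : a ∈ l := by
  obtain ⟨φ, hφ⟩ := (Algebra.linearMap k K).exists_leftInverse_of_injective
    (LinearMap.ker_eq_bot.mpr (algebraMap k K).injective)
  have h1 : φ 1 = 1 := by simpa using congrArg (fun g => g 1) hφ
  have h2 (t : K ⊗[k] l) : TensorProduct.lid k E
      (φ.rTensor E (Algebra.TensorProduct.map (AlgHom.id k K) l.val t)) =
        (TensorProduct.lid k l (φ.rTensor l t) : l) := by
    induction t with
    | zero => simp
    | tmul x y => simp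
    | add x y hx hy => simp only [map_add, hx, hy]; rfl
  have h3 := h2 t
  rw [h] at h3
  simp only [LinearMap.rTensor_tmul, h1, TensorProduct.lid_tmul, one_smul] at h3
  exact h3 ▸ SetLike.coe_mem _

end

/-! ### Closed subschemes of X ×_k E for E of height one, and towers. -/

namespace Elemental

noncomputable section

lemma functionFieldMap_apply_of_comp_eq {X Y Z : Scheme.{u}} [IsIntegral X] [IsIntegral Y]
    [IsIntegral Z] (h : Z ⟶ Y) (g : Y ⟶ X) {q : Z ⟶ X} [IsDominant h] [IsDominant g] [IsDominant q]
    (e : h ≫ g = q) (x : X.functionField) :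
    q.functionFieldMap.hom x = h.functionFieldMap.hom (g.functionFieldMap.hom x) := by
  subst e
  rw [Scheme.Hom.functionFieldMap_comp]
  rfl

lemma IsAlgClosureIn.comp_bijective {F E K K' : Type u} [Field F] [Field E] [CommRing K]
    [CommRing K'] {φ : F →+* K} {ι : E →+* K} (h : IsAlgClosureIn φ ι) (ψ : K →+* K')
    (hψ : Function.Bijective ψ) : IsAlgClosureIn (ψ.comp φ) (ψ.comp ι) := by
  intro x
  obtain ⟨y, rfl⟩ := hψ.2 x
  let := φ.toAlgebra
  let := (ψ.comp φ).toAlgebra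
  let ψ' : K →ₐ[F] K' := { ψ with commutes' := fun _ => rfl }
  change _ ↔ IsAlgebraic F (ψ' y)
  rw [isAlgebraic_algHom_iff ψ' hψ.1, ← show y ∈ ι.range ↔ IsAlgebraic F y from h y]
  constructor
  · rintro ⟨z, hz⟩
    exact ⟨z, hψ.1 hz⟩
  · rintro ⟨z, rfl⟩
    exact ⟨z, rfl⟩

section ClosedSubscheme

variable {k : Type u} [Field k] {X Y : Scheme.{u}} [IsIntegral X] [IsIntegral Y]
  {f : X ⟶ Spec (.of k)} {E : Type u} [Field E] [Algebra k E] (p : ℕ) [Fact p.Prime] [CharP k p]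
  (hE : ∀ x : E, x ^ p ∈ (algebraMap k E).range) (j : Y ⟶ baseChange f E) [IsClosedImmersion j]
  {q : Y ⟶ X} [IsDominant q] {r : Y ⟶ Spec (.of E)} (hq : j ≫ pullback.fst f (specMap k E) = q)
  (hr : j ≫ pullback.snd f (specMap k E) = r)

include hq hr

omit [IsClosedImmersion j] in
lemma functionFieldMap_comp_toFunctionField :
    q.functionFieldMap.hom.comp (toFunctionField f) =
      (toFunctionField r).comp (algebraMap k E) := by
  rw [← toFunctionField_comp, ← toFunctionField_specMap_comp, ← hq, ← hr, Category.assoc,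
    Category.assoc, pullback.condition]

include hE

omit hr in
-- The elements with p-th power in K(X) form a subfield that contains the generators K(X) and E.
lemma exists_functionFieldMap_eq_pow (y : Y.functionField) :
    ∃ x : X.functionField, q.functionFieldMap.hom x = y ^ p := by
  have : CharP E p := charP_of_injective_algebraMap (algebraMap k E).injective p
  have : CharP Y.functionField p := charP_of_injective_ringHom
    (toFunctionField (j ≫ pullback.snd f (specMap k E))).injective p
  let S : Subfield Y.functionField :=
    q.functionFieldMap.hom.fieldRange.comap (frobenius Y.functionField p)
  have hS : S = ⊤ := by
    subst hq
    refine eq_top_of_range_functionFieldMap_le f E j S (fun x => ⟨x ^ p, map_pow _ _ _⟩) fun x => ?_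
    obtain ⟨c, hc⟩ := hE x
    refine ⟨toFunctionField f c, ?_⟩
    have := congrArg (fun g => g c)
      (functionFieldMap_comp_toFunctionField (f := f) (E := E) j rfl rfl)
    rw [frobenius_def, ← map_pow, ← hc]
    exact this
  exact (hS ▸ Subfield.mem_top y : y ∈ S)

/-- The image of K(X) ⊗ E is already a subfield because E^p ⊂ k, and it contains the generators. -/
lemma exists_surjective_tensorProduct :
    letI := functionFieldAlgebra f
    ∃ T : X.functionField ⊗[k] E →+* Y.functionField,
      (∀ x y, T (x ⊗ₜ y) = q.functionFieldMap.hom x * toFunctionField r y) ∧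
        Function.Surjective T := by
  let := functionFieldAlgebra f
  obtain ⟨T, hT⟩ := TensorProduct.exists_ringHom_tmul_eq_mul (k := k) q.functionFieldMap.hom
    (toFunctionField r) (functionFieldMap_comp_toFunctionField j hq hr)
  refine ⟨T, hT, fun y => ?_⟩
  have hS : TensorProduct.rangeSubfield p hE T = ⊤ := by
    subst hq hr
    exact eq_top_of_range_functionFieldMap_le f E j _ (fun x => ⟨x ⊗ₜ 1, by simp [hT]⟩)
      fun x => ⟨1 ⊗ₜ x, by simp [hT]⟩
  exact (hS ▸ Subfield.mem_top y : y ∈ TensorProduct.rangeSubfield p hE T)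

end ClosedSubscheme

instance surjective_specMap (k E : Type u) [Field k] [Field E] [Algebra k E] :
    Surjective (specMap k E) :=
  ⟨fun _ => ⟨IsLocalRing.closedPoint E, Subsingleton.elim _ _⟩⟩

instance surjective_pullback_fst_specMap {k : Type u} [Field k] {X : Scheme.{u}}
    (f : X ⟶ Spec (.of k)) (E : Type u) [Field E] [Algebra k E] :
    Surjective (pullback.fst f (specMap k E)) :=
  MorphismProperty.of_isPullback (IsPullback.of_hasPullback f (specMap k E)).flip
    (surjective_specMap k E)

instance surjective_redι (Y : Scheme.{u}) : Surjective (redι Y) := by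
  refine ⟨?_⟩
  rw [← Set.range_eq_univ, Scheme.IdealSheafData.range_subschemeι, Scheme.support_nilradical]
  rfl

section Tower

variable {k : Type u} [Field k] {X : Scheme.{u}} (f : X ⟶ Spec (.of k)) (l E : Type u) [Field l]
  [Field E] [Algebra k l] [Algebra k E] [Algebra l E] [IsScalarTower k l E]

omit f in
lemma specMap_comp_specMap : specMap l E ≫ specMap k l = specMap k E := by
  rw [← Spec.map_comp, ← CommRingCat.ofHom_comp, ← IsScalarTower.algebraMap_eq]

/-- The morphism `X ×_k E ⟶ X ×_k l` of a tower of field extensions `E / l / k`. -/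
def baseChangeMap : baseChange f E ⟶ baseChange f l :=
  pullback.lift (pullback.fst f (specMap k E)) (pullback.snd f (specMap k E) ≫ specMap l E) (by
    rw [Category.assoc, specMap_comp_specMap, pullback.condition])

lemma baseChangeMap_fst : baseChangeMap f l E ≫ pullback.fst f (specMap k l) =
    pullback.fst f (specMap k E) :=
  pullback.lift_fst _ _ _

lemma baseChangeMap_snd : baseChangeMap f l E ≫ pullback.snd f (specMap k l) =
    pullback.snd f (specMap k E) ≫ specMap l E :=
  pullback.lift_snd _ _ _

lemma isPullback_baseChangeMap : IsPullback (pullback.snd f (specMap k E)) (baseChangeMap f l E)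
    (specMap l E) (pullback.snd f (specMap k l)) := by
  refine .of_bot (v₂₁ := pullback.fst f (specMap k l)) (h₃₁ := f) (v₂₂ := specMap k l) ?_
    (baseChangeMap_snd f l E).symm (IsPullback.of_hasPullback f (specMap k l)).flip
  rw [baseChangeMap_fst, specMap_comp_specMap]
  exact (IsPullback.of_hasPullback f (specMap k E)).flip

instance surjective_baseChangeMap : Surjective (baseChangeMap f l E) :=
  MorphismProperty.of_isPullback (isPullback_baseChangeMap f l E) (surjective_specMap l E)

instance isIntegralHom_baseChangeMap [Algebra.IsAlgebraic l E] :
    IsIntegralHom (baseChangeMap f l E) :=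
  MorphismProperty.of_isPullback (isPullback_baseChangeMap f l E) (by
    rw [IsIntegralHom.SpecMap_iff]
    exact (inferInstance : Algebra.IsIntegral l E).isIntegral)

end Tower

/-! ### The field k^{1/p} and the three assertions. -/

section RootField

variable {k : Type u} [Field k] {p : ℕ} [Fact p.Prime] [CharP k p]

lemma exists_pow_eq_algebraMap_rootField (c : k) :
    ∃ b : rootField k p, b ^ p = algebraMap k (rootField k p) c := by
  obtain ⟨z, hz⟩ := IsAlgClosed.exists_pow_nat_eq (algebraMap k (AlgebraicClosure k) c)
    (Fact.out : p.Prime).pos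
  exact ⟨⟨z, c, hz.symm⟩, Subtype.ext hz⟩

lemma pow_mem_range_rootField (x : rootField k p) :
    x ^ p ∈ (algebraMap k (rootField k p)).range := by
  obtain ⟨c, hc⟩ := x.2
  exact ⟨c, Subtype.ext hc⟩

lemma pow_mem_range_intermediateField (l : IntermediateField k (rootField k p)) (x : l) :
    x ^ p ∈ (algebraMap k l).range := by
  obtain ⟨c, hc⟩ := pow_mem_range_rootField (x : rootField k p)
  exact ⟨c, Subtype.ext hc⟩

/-- Two embeddings of `k^{1/p}` into a field that agree on `k` are equal. -/
lemma rootField_ringHom_ext {L : Type*} [Field L] {a b : rootField k p →+* L}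
    (h : a.comp (algebraMap k _) = b.comp (algebraMap k _)) : a = b := by
  have : CharP (rootField k p) p :=
    charP_of_injective_algebraMap (algebraMap k (rootField k p)).injective p
  have : CharP L p := charP_of_injective_ringHom a.injective p
  ext x
  obtain ⟨c, hc⟩ := pow_mem_range_rootField x
  refine frobenius_inj L p ?_
  rw [frobenius_def, frobenius_def, ← map_pow, ← map_pow, ← hc]
  exact congrArg (fun g => g c) h

variable {X : Scheme.{u}} [IsIntegral X] {f : X ⟶ Spec (.of k)}

/-- If x is algebraic over l, then x^p comes from K(X) and is algebraic over k, so it is some c ∈ k;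
by injectivity of Frobenius, x is the image of c^{1/p}. -/
lemma isAlgClosureIn_of_comp_eq (hk : IsAlgClosedInFunctionField f)
    (l : IntermediateField k (rootField k p)) [IsIntegral (baseChange f l)]
    (ι : rootField k p →+* (baseChange f l).functionField)
    (hι : ι.comp (algebraMap l (rootField k p)) =
      toFunctionField (pullback.snd f (specMap k l))) :
    IsAlgClosureIn (toFunctionField (pullback.snd f (specMap k l))) ι := by
  have : CharP (rootField k p) p :=
    charP_of_injective_algebraMap (algebraMap k (rootField k p)).injective p
  have : CharP (baseChange f l).functionField p := charP_of_injective_ringHom ι.injective p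
  let := functionFieldAlgebra f
  let := functionFieldAlgebra (pullback.snd f (specMap k l))
  let := (pullback.fst f (specMap k l)).functionFieldMap.hom.toAlgebra
  let := functionFieldAlgebra (pullback.snd f (specMap k l) ≫ specMap k l)
  have hcomp := functionFieldMap_comp_toFunctionField (f := f) (E := l) (𝟙 (baseChange f l))
    (Category.id_comp _) (Category.id_comp _)
  have : IsScalarTower k l (baseChange f l).functionField :=
    .of_algebraMap_eq' (toFunctionField_specMap_comp _)
  have : IsScalarTower k X.functionField (baseChange f l).functionField :=
    .of_algebraMap_eq' ((toFunctionField_specMap_comp _).trans hcomp.symm)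
  intro x
  change _ ↔ IsAlgebraic l x
  constructor
  · rintro ⟨y, rfl⟩
    obtain ⟨c, hc⟩ := pow_mem_range_rootField y
    refine IsAlgebraic.of_pow (Fact.out : p.Prime).pos ?_
    rw [← map_pow, ← hc, IsScalarTower.algebraMap_apply k l (rootField k p)]
    have := congrArg (fun g => g (algebraMap k l c)) hι
    exact this ▸ isAlgebraic_algebraMap (algebraMap k l c)
  · intro hx
    have hx' : IsAlgebraic k x := hx.restrictScalars k
    obtain ⟨z, hz⟩ := exists_functionFieldMap_eq_pow p (pow_mem_range_intermediateField l)
      (𝟙 (baseChange f l)) (Category.id_comp _) x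
    have hz' : IsAlgebraic k z := by
      refine (isAlgebraic_algebraMap_iff
        (algebraMap X.functionField (baseChange f l).functionField).injective).mp ?_
      exact hz ▸ hx'.pow p
    obtain ⟨c, rfl⟩ := (hk z).mpr hz'
    obtain ⟨b, hb⟩ := exists_pow_eq_algebraMap_rootField (p := p) c
    refine ⟨b, frobenius_inj _ p ?_⟩
    rw [frobenius_def, frobenius_def, ← hz, ← map_pow, hb,
      IsScalarTower.algebraMap_apply k l (rootField k p)]
    exact (congrArg (fun g => g (algebraMap k l c)) hι).trans
      (congrArg (fun g => g c) hcomp).symm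

lemma exists_isRootClosure (hk : IsAlgClosedInFunctionField f) :
    ∃ l : IntermediateField k (rootField k p), IsRootClosure p f l := by
  let := functionFieldAlgebra f
  let F := AlgebraicClosure X.functionField
  let φ : X.functionField →ₐ[k] F := IsScalarTower.toAlgHom k _ _
  let σ : rootField k p →ₐ[k] F := IsAlgClosed.lift
  obtain ⟨l, hl, hσ⟩ := IntermediateField.exists_isDisjointFrom_forall_mem_range p
    (φ := φ) (σ := σ) pow_mem_range_rootField
  let P := Algebra.TensorProduct.productMap φ (σ.comp l.val)
  have hred : IsReduced (baseChange f l) := (isReduced_baseChange_iff f l).mpr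
    (isReduced_of_injective P hl)
  have hint : IsIntegral (baseChange f l) := isIntegral_of_irreducibleSpace_of_isReduced _
  -- X ×_k l is taken as a closed subscheme of itself.
  obtain ⟨T, hT, -⟩ := exists_surjective_tensorProduct p (pow_mem_range_intermediateField l)
    (𝟙 (baseChange f l)) (Category.id_comp _) (Category.id_comp _)
  let e := AlgEquiv.ofInjective P hl
  let σ' : rootField k p →ₐ[k] P.range := σ.codRestrict P.range hσ
  -- k^{1/p} lands in the compositum of K(X) and l in F, which is K(X) ⊗ l by disjointness.
  let ι := T.comp (e.symm.toAlgHom.comp σ').toRingHom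
  have hι : ι.comp (algebraMap l (rootField k p)) =
      toFunctionField (pullback.snd f (specMap k l)) := by
    ext x
    have h : e.symm (σ' (algebraMap l (rootField k p) x)) = 1 ⊗ₜ x := by
      rw [AlgEquiv.symm_apply_eq]
      refine Subtype.ext ?_
      change σ x = P (1 ⊗ₜ x)
      simp [P]
    change T (e.symm (σ' (algebraMap l (rootField k p) x))) = _
    rw [h, hT, map_one, one_mul]
  exact ⟨l, hint, ι, hι, isAlgClosureIn_of_comp_eq hk l ι hι⟩

section IsRootClosure

variable (l : IntermediateField k (rootField k p)) [IsIntegral (baseChange f l)]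

/-- The morphism `(X ×_k k^{1/p})_red ⟶ X ×_k l`. -/
abbrev redBaseChangeMap (f : X ⟶ Spec (.of k)) (l : IntermediateField k (rootField k p)) :
    red (baseChange f (rootField k p)) ⟶ baseChange f l :=
  redι _ ≫ baseChangeMap f l (rootField k p)

/-- The structure morphism of `(X ×_k k^{1/p})_red`. -/
abbrev redSnd (f : X ⟶ Spec (.of k)) (p : ℕ) [Fact p.Prime] [CharP k p] :
    red (baseChange f (rootField k p)) ⟶ Spec (.of (rootField k p)) :=
  redι _ ≫ pullback.snd f (specMap k (rootField k p))

variable (ι : rootField k p →+* (baseChange f l).functionField)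
  (hι : ι.comp (algebraMap l (rootField k p)) = toFunctionField (pullback.snd f (specMap k l)))

include hι

lemma functionFieldMap_redBaseChangeMap_comp :
    (redBaseChangeMap f l).functionFieldMap.hom.comp ι = toFunctionField (redSnd f p) := by
  refine rootField_ringHom_ext ?_
  rw [IsScalarTower.algebraMap_eq k l (rootField k p), ← RingHom.comp_assoc, ← RingHom.comp_assoc,
    RingHom.comp_assoc _ ι, hι, ← toFunctionField_comp, ← toFunctionField_specMap_comp,
    RingHom.comp_assoc, ← IsScalarTower.algebraMap_eq, ← toFunctionField_specMap_comp,
    Category.assoc, Category.assoc, Category.assoc,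
    reassoc_of% baseChangeMap_snd f l (rootField k p), specMap_comp_specMap]

/-- Both generators, K(X) and k^{1/p}, come from K(X ×_k l), the latter through `ι`. -/
lemma bijective_functionFieldMap_redBaseChangeMap :
    Function.Bijective (redBaseChangeMap f l).functionFieldMap.hom := by
  refine ⟨RingHom.injective _, fun y => ?_⟩
  have hS : (redBaseChangeMap f l).functionFieldMap.hom.fieldRange = ⊤ := by
    refine eq_top_of_range_functionFieldMap_le f (rootField k p) (redι _) _ (fun x => ?_)
      fun x => ⟨ι x, ?_⟩
    · refine ⟨(pullback.fst f (specMap k l)).functionFieldMap.hom x, ?_⟩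
      refine (functionFieldMap_apply_of_comp_eq _ _ ?_ x).symm
      rw [Category.assoc, baseChangeMap_fst]
    · exact congrArg (fun g => g x) (functionFieldMap_redBaseChangeMap_comp l ι hι)
  exact (hS ▸ Subfield.mem_top y : y ∈ (redBaseChangeMap f l).functionFieldMap.hom.fieldRange)

lemma isElementalExtension_of_isAlgClosureIn
    (h : IsAlgClosureIn (toFunctionField (pullback.snd f (specMap k l))) ι) :
    IsElementalExtension p (k := k) (l := l) (k' := rootField k p) f
      (fromReducedNormalisation (baseChange f (rootField k p)) ≫
        pullback.fst f (specMap k (rootField k p)))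
      (fromReducedNormalisation (baseChange f (rootField k p)) ≫
        pullback.snd f (specMap k (rootField k p))) := by
  have hbij := bijective_functionFieldMap_redBaseChangeMap l ι hι
  have hcomm : (fromReducedNormalisation (baseChange f (rootField k p)) ≫
      pullback.fst f (specMap k (rootField k p))) ≫ f =
      ((fromReducedNormalisation (baseChange f (rootField k p)) ≫
        pullback.snd f (specMap k (rootField k p))) ≫ specMap l (rootField k p)) ≫
          specMap k l := by
    rw [Category.assoc, Category.assoc _ (specMap l _), specMap_comp_specMap, pullback.condition]
    simp only [Category.assoc]
  refine ⟨inferInstance, pow_mem_range_intermediateField l, inferInstance, hcomm, ?_,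
    inferInstance, ?_⟩
  · have := isNormalisation_fromNormalisation_comp (redBaseChangeMap f l) hbij
    convert this using 1
    apply pullback.hom_ext
    · rw [pullback.lift_fst]
      simp only [Category.assoc, baseChangeMap_fst]
    · rw [pullback.lift_snd]
      simp only [Category.assoc, baseChangeMap_snd]
  · let n := fromNormalisation (red (baseChange f (rootField k p)))
    have h₁ : toFunctionField ((fromReducedNormalisation (baseChange f (rootField k p)) ≫
        pullback.snd f (specMap k (rootField k p))) ≫ specMap l (rootField k p)) =
        (n.functionFieldMap.hom.comp (redBaseChangeMap f l).functionFieldMap.hom).comp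
          (toFunctionField (pullback.snd f (specMap k l))) := by
      rw [RingHom.comp_assoc, ← toFunctionField_comp, ← toFunctionField_comp]
      congr 1
      simp only [Category.assoc, baseChangeMap_snd, n]
    have h₂ : toFunctionField (fromReducedNormalisation (baseChange f (rootField k p)) ≫
        pullback.snd f (specMap k (rootField k p))) =
        (n.functionFieldMap.hom.comp (redBaseChangeMap f l).functionFieldMap.hom).comp ι := by
      rw [RingHom.comp_assoc, functionFieldMap_redBaseChangeMap_comp l ι hι,
        ← toFunctionField_comp, Category.assoc]
    rw [h₁, h₂]
    have hn : Function.Bijective n.functionFieldMap.hom :=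
      bijective_functionFieldMap_fromNormalisation
    exact h.comp_bijective (n.functionFieldMap.hom.comp (redBaseChangeMap f l).functionFieldMap.hom)
      (hn.comp hbij)

/-- For a ∈ k^{1/p}, lift `ι a` to t ∈ K(X) ⊗ l. In K(X) ⊗ k^{1/p}, which embeds in a function field
by reducedness, t becomes 1 ⊗ a, so a ∈ l. -/
lemma eq_top_of_isReduced_baseChange (h : IsReduced (baseChange f (rootField k p))) :
    l = ⊤ := by
  let := functionFieldAlgebra f
  have := (isReduced_baseChange_iff f (rootField k p)).mp h
  obtain ⟨T, hT, hTs⟩ := exists_surjective_tensorProduct p (pow_mem_range_intermediateField l)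
    (𝟙 (baseChange f l)) (Category.id_comp _) (Category.id_comp _)
  obtain ⟨T', hT', -⟩ := exists_surjective_tensorProduct p pow_mem_range_rootField
    (redι (baseChange f (rootField k p))) rfl rfl
  have hinj := TensorProduct.ringHom_injective_of_isReduced p pow_mem_range_rootField T'
  have hsnd (x : rootField k p) := congrArg (fun g => g x)
    (functionFieldMap_redBaseChangeMap_comp l ι hι)
  have hTT' (t : X.functionField ⊗[k] l) : (redBaseChangeMap f l).functionFieldMap.hom (T t) =
      T' (Algebra.TensorProduct.map (AlgHom.id k X.functionField) l.val t) := by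
    induction t with
    | zero => simp only [map_zero]
    | add x y hx hy => simp only [map_add, hx, hy]
    | tmul x y =>
      rw [Algebra.TensorProduct.map_tmul, hT, hT', map_mul]
      congr 1
      · refine (functionFieldMap_apply_of_comp_eq _ _ ?_ x).symm
        rw [Category.assoc, baseChangeMap_fst]
      · rw [← hι]
        exact hsnd y
  refine top_unique fun a _ => ?_
  obtain ⟨t, ht⟩ := hTs (ι a)
  refine IntermediateField.mem_of_map_val_eq_one_tmul (t := t) (hinj ?_)
  rw [← hTT', ht, hT', map_one, one_mul]
  exact hsnd a

end IsRootClosure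

lemma geometricallyReduced_of_isIntegral_baseChange
    [IsIntegral (baseChange f (⊤ : IntermediateField k (rootField k p)))] :
    GeometricallyReduced f := by
  let := functionFieldAlgebra f
  have : _root_.IsReduced (X.functionField ⊗[k] (⊤ : IntermediateField k (rootField k p))) :=
    (isReduced_baseChange_iff f _).mp inferInstance
  rw [geometricallyReduced_iff, geometrically_iff_of_commRing_of_isClosedUnderIsomorphisms]
  intro E _ _
  refine (isReduced_baseChange_iff f E).mpr
    (TensorProduct.isReduced_of_isReduced_of_forall_exists_pow p
      (E := (⊤ : IntermediateField k (rootField k p))) (fun c => ?_) E)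
  obtain ⟨b, hb⟩ := exists_pow_eq_algebraMap_rootField (p := p) c
  exact ⟨⟨b, trivial⟩, Subtype.ext hb⟩

end RootField

end

end Elemental

theorem mainTheorem6 (k : Type u) [Field k] (p : ℕ) [Fact p.Prime] [CharP k p]
    (X : Scheme.{u}) (f : X ⟶ Spec (.of k))
    [IsIntegral X] [LocallyOfFiniteType f] [QuasiCompact f] [IsSeparated f]
    (hk : Elemental.IsAlgClosedInFunctionField f) :
    (∃ l : IntermediateField k (Elemental.rootField k p), Elemental.IsRootClosure p f l) ∧
    (∀ l : IntermediateField k (Elemental.rootField k p), Elemental.IsRootClosure p f l →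
      Elemental.IsElementalExtension p (k := k) (l := l) (k' := Elemental.rootField k p) f
        (Elemental.fromReducedNormalisation (Elemental.baseChange f (Elemental.rootField k p)) ≫
          pullback.fst f (Elemental.specMap k (Elemental.rootField k p)))
        (Elemental.fromReducedNormalisation (Elemental.baseChange f (Elemental.rootField k p)) ≫
          pullback.snd f (Elemental.specMap k (Elemental.rootField k p)))) ∧
    (∀ l : IntermediateField k (Elemental.rootField k p), Elemental.IsRootClosure p f l →
      (GeometricallyReduced f ↔ l = ⊤)) := by
  refine ⟨Elemental.exists_isRootClosure hk, ?_, ?_⟩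
  · rintro l ⟨_, ι, hι, h⟩
    exact Elemental.isElementalExtension_of_isAlgClosureIn l ι hι h
  · rintro l ⟨_, ι, hι, h⟩
    constructor
    · intro hf
      exact Elemental.eq_top_of_isReduced_baseChange l ι hι
        (pullback_of_geometrically hf.geometrically_isReduced _ _)
    · rintro rfl
      exact Elemental.geometricallyReduced_of_isIntegral_baseChange (p := p)
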